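/- Let $E=\{(i,j)\in\mathbb N^2 : i<j\}$ be the edge set of the directed graph $(\mathbb N,<)$. A random subgraph of $(\mathbb N,<)$ on a probability space $(\Omega,\mathcal A,\mu)$ is a measurable map $X:\Omega\to 2^{E}$, where $2^{E}=\{0,1\}^{E}$ carries the product $\sigma$-algebra; equivalently, it is a family of measurable sets $X_{i,j}=\{x\in\Omega : (i,j)\in X(x)\}$, $i<j$. No independence of the events $X_{i,j}$ is assumed. An infinite path of $X(x)$ is a sequence $n_0<n_1<n_2<\cdots$ of natural numbers with $(n_k,n_{k+1})\in X(x)$ for all $k$. (1) Let $X$ be a random subgraph of $(\mathbb N,<)$ on an arbitrary probability space $(\Omega,\mathcal A,\mu)$ such that $\mu(X_{i,j})\ge \tfrac12$ for all $i<j$. Then the set $P=\{x\in\Omega : X(x)\text{ has an infinite path}\}$ is $\mu$-measurable (that is, measurable for the completion of $\mu$) and $\mu(P)>0$. In particular there is a strictly increasing sequence $(n_k)_{k\in\mathbb N}$ of natural numbers with $\bigcap_{k} X_{n_k,n_{k+1}}\neq\emptyset$. (2) The bound $\tfrac12$ is sharp: for every real $r<\tfrac12$ there are a probability space $(\Omega,\mathcal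 A,\mu)$ and a random subgraph $X$ of $(\mathbb N,<)$ on it such that $\mu(X_{i,j})\ge r$ for all $i<j$, while $X(x)$ has no infinite path for any $x\in\Omega$. -/

import Mathlib

open MeasureTheory

/-- The edges `(i, j)`, `i < j`, of the directed graph `(ℕ, <)`. -/
abbrev NatEdge : Type := {e : ℕ × ℕ // e.1 < e.2}

/-- A random subgraph of `(ℕ, <)` on the measurable space `Ω`: a measurable map from `Ω` to the
power set of the edge set. Here `Set NatEdge` carries Mathlib's product σ-algebra of
`NatEdge → Prop`, which is the Borel σ-algebra of `{0, 1} ^ NatEdge` as `NatEdge` is countable. -/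
def IsRandomSubgraph {Ω : Type*} [MeasurableSpace Ω] (X : Ω → Set NatEdge) : Prop :=
  Measurable X

/-- The event that the random subgraph `X` contains the edge `e`. -/
def edgeEvent {Ω : Type*} (X : Ω → Set NatEdge) (e : NatEdge) : Set Ω :=
  {x | e ∈ X x}

/-- The subgraph of `(ℕ, <)` with edge set `H` has an infinite path: there are vertices
`v 0, v 1, v 2, …` such that every `(v k, v (k + 1))` is an edge of `(ℕ, <)` that lies in `H`
(so `v` is automatically strictly increasing). -/
def HasInfinitePath (H : Set NatEdge) : Prop :=
  ∃ v : ℕ → ℕ, ∀ k : ℕ, ∃ h : v k < v (k + 1), (⟨(v k, v (k + 1)), h⟩ : NatEdge) ∈ H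

/-- The event that the random subgraph `X` has an infinite path. -/
def infinitePathEvent {Ω : Type*} (X : Ω → Set NatEdge) : Set Ω :=
  {x | HasInfinitePath (X x)}

open Filter Topology

/-! If there is almost surely no infinite path, vertices have ordinal ranks, and an edge (i, j)
forces the rank to drop from i to j. The probabilities of "rank ≥ a" are stationary at one countable
a for all vertices (`Ordinal.exists_lt_omega_one_forall_eq`); there the events must be null, so
almost all ranks lie below a, in a countable well-order.

It remains that random variables φ i in such an order cannot satisfy P(φ j < φ i) ≥ 1/2 for all i <
j (`exists_lt_measureReal_lt_half`). Let g a be the weak L² limit of the indicators of φ i < a along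
an ultrafilter. The iterated limit of P(φ j < φ i) is, heuristically, a sum of ⟨g b, g c - g b⟩ over
the jumps of g, each at most (‖g c‖² - ‖g b‖²) / 2. This telescopes to at most 1/2, and the first
jump, from 0, contributes nothing: hence strictness.

For sharpness, independent labels in a finite set descend with probability near 1/2, but never
forever. -/

/-- Bounded families in a Hilbert space converge weakly along every ultrafilter. -/
theorem exists_tendsto_inner_of_norm_le {H ι : Type*} [NormedAddCommGroup H]
    [InnerProductSpace ℝ H] [CompleteSpace H] (U : Ultrafilter ι) (u : ι → H) (r : ℝ)
    (hu : ∀ i, ‖u i‖ ≤ r) :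
    ∃ g : H, ∀ f : H, Tendsto (fun i => inner ℝ (u i) f) U (𝓝 (inner ℝ g f)) := by
  let F : ι → WeakDual ℝ H := fun i => StrongDual.toWeakDual (InnerProductSpace.toDual ℝ H (u i))
  have hK := WeakDual.isCompact_closedBall (𝕜 := ℝ) (E := H) 0 r
  obtain ⟨y, -, hy⟩ := hK.ultrafilter_le_nhds (U.map F) (by
    refine le_principal_iff.2 (Filter.Eventually.of_forall (f := (U : Filter ι)) fun i => ?_)
    simpa [F] using hu i)
  refine ⟨(InnerProductSpace.toDual ℝ H).symm (WeakDual.toStrongDual y), fun f => ?_⟩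
  have h2 : Tendsto (fun i => F i f) U (𝓝 (y f)) :=
    ((WeakDual.eval_continuous f).tendsto y).comp hy
  rw [InnerProductSpace.toDual_symm_apply]
  simpa [F] using h2

/-! ### Random variables in a countable well-order -/

section Ranks

variable {Ω W : Type*} [MeasurableSpace Ω] [LinearOrder W] {μ : Measure Ω}

/-- The mass that a random variable gives to a left-closed interval is almost carried by an
initial part of it, also if the interval has no largest element. -/
theorem exists_measureReal_Ioo_le [WellFoundedLT W] [Countable W] [MeasurableSpace W]
    [DiscreteMeasurableSpace W] [IsFiniteMeasure μ] {φ : Ω → W} (hφ : Measurable φ)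
    {b c : W} (hbc : b < c) {η : ℝ} (hη : 0 < η) :
    ∃ m, b ≤ m ∧ m < c ∧ μ.real {x | m < φ x ∧ φ x < c} ≤ η := by
  let S : Set.Ico b c → Set Ω := fun m => {x | (m : W) < φ x ∧ φ x < c}
  have : Nonempty (Set.Ico b c) := ⟨⟨b, le_rfl, hbc⟩⟩
  have hS : Antitone S := fun m n hmn x hx => ⟨lt_of_le_of_lt (α := W) hmn hx.1, hx.2⟩
  have hmeas : ∀ m, MeasurableSet (S m) := fun m =>
    hφ (MeasurableSet.of_discrete (s := Set.Ioo (m : W) c))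
  have hempty : ⋂ m, S m = ∅ := by
    refine Set.eq_empty_iff_forall_notMem.2 fun x hx => ?_
    rw [Set.mem_iInter] at hx
    have h0 := hx ⟨b, le_rfl, hbc⟩
    exact lt_irrefl _ (hx ⟨φ x, h0.1.le, h0.2⟩).1
  have ht := tendsto_measure_iInter_atTop (μ := μ) (fun m => (hmeas m).nullMeasurableSet) hS
    ⟨⟨b, le_rfl, hbc⟩, measure_ne_top _ _⟩
  rw [hempty, measure_empty] at ht
  obtain ⟨m, hm⟩ := (ht.eventually (gt_mem_nhds (ENNReal.ofReal_pos.2 hη))).exists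
  exact ⟨m, m.2.1, m.2.2, ENNReal.toReal_le_of_le_ofReal hη.le hm.le⟩

variable [MeasurableSpace W] [DiscreteMeasurableSpace W] [IsProbabilityMeasure μ] {φ : ℕ → Ω → W}

/-- The indicator of the event `φ i < a`, as an element of `L²`. -/
noncomputable def ltIndicator (μ : Measure Ω) [IsProbabilityMeasure μ] (hφ : ∀ i, Measurable (φ i))
    (i : ℕ) (a : W) : Lp ℝ 2 μ :=
  indicatorConstLp 2 (hφ i (MeasurableSet.of_discrete (s := Set.Iio a))) (measure_ne_top μ _) 1

theorem inner_ltIndicator (hφ : ∀ i, Measurable (φ i)) (i j : ℕ) (a b : W) :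
    inner ℝ (ltIndicator μ hφ i a) (ltIndicator μ hφ j b) =
      μ.real {x | φ i x < a ∧ φ j x < b} := by
  rw [ltIndicator, ltIndicator, L2.inner_indicatorConstLp_indicatorConstLp]
  simp
  rfl

theorem norm_ltIndicator_sub_le (hφ : ∀ i, Measurable (φ i)) (i : ℕ) {a b : W} (hab : a ≤ b) :
    ‖ltIndicator μ hφ i b - ltIndicator μ hφ i a‖ ≤ 1 := by
  have h : ‖ltIndicator μ hφ i b - ltIndicator μ hφ i a‖ ^ 2 ≤ 1 ^ 2 := by
    rw [norm_sub_sq_real, ← real_inner_self_eq_norm_sq, ← real_inner_self_eq_norm_sq,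
      inner_ltIndicator, inner_ltIndicator, inner_ltIndicator]
    have h1 : {x | φ i x < b ∧ φ i x < a} = {x | φ i x < a ∧ φ i x < a} := by
      ext x; simp only [Set.mem_ofPred_eq, and_self, and_iff_right_iff_imp]
      exact fun h => h.trans_le hab
    rw [h1]
    have h2 := measureReal_le_one (μ := μ) (s := {x | φ i x < b ∧ φ i x < b})
    have h3 := measureReal_nonneg (μ := μ) (s := {x | φ i x < a ∧ φ i x < a})
    linarith
  exact le_of_sq_le_sq h zero_le_one

theorem norm_ltIndicator_le (hφ : ∀ i, Measurable (φ i)) (i : ℕ) (a : W) :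
    ‖ltIndicator μ hφ i a‖ ≤ 1 := by
  have h : ‖ltIndicator μ hφ i a‖ ^ 2 ≤ 1 ^ 2 := by
    rw [← real_inner_self_eq_norm_sq, inner_ltIndicator, one_pow]
    exact measureReal_le_one
  exact le_of_sq_le_sq h zero_le_one

/-- `g a` is the weak `L²` limit of the indicators of `φ i < a` along `U`. -/
def IsWeakRankLimit (U : Ultrafilter ℕ) (hφ : ∀ i, Measurable (φ i)) (g : W → Lp ℝ 2 μ) : Prop :=
  ∀ a f, Tendsto (fun i => inner ℝ (ltIndicator μ hφ i a) f) U (𝓝 (inner ℝ (g a) f))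

theorem exists_isWeakRankLimit (U : Ultrafilter ℕ) (hφ : ∀ i, Measurable (φ i)) :
    ∃ g : W → Lp ℝ 2 μ, IsWeakRankLimit U hφ g := by
  choose g hg using fun a => exists_tendsto_inner_of_norm_le U (fun i => ltIndicator μ hφ i a) 1
    fun i => norm_ltIndicator_le hφ i a
  exact ⟨g, hg⟩

namespace IsWeakRankLimit

variable {U : Ultrafilter ℕ} {hφ : ∀ i, Measurable (φ i)} {g : W → Lp ℝ 2 μ}

/-- Both sides are iterated limits along `U` of probabilities that already compare before the
limits. -/
theorem norm_sq_le_inner (hg : IsWeakRankLimit U hφ g) {a b : W} (hab : a ≤ b) :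
    ‖g a‖ ^ 2 ≤ inner ℝ (g b) (g a) := by
  rw [← real_inner_self_eq_norm_sq]
  refine le_of_tendsto_of_tendsto' (hg a (g a)) (hg b (g a)) fun i => ?_
  rw [real_inner_comm, real_inner_comm (g a)]
  refine le_of_tendsto_of_tendsto' (hg a _) (hg a _) fun j => ?_
  rw [inner_ltIndicator, inner_ltIndicator]
  exact measureReal_mono fun x hx => ⟨hx.1, hx.2.trans_le hab⟩

theorem norm_sq_sub_le (hg : IsWeakRankLimit U hφ g) {a b : W} (hab : a ≤ b) :
    ‖g b - g a‖ ^ 2 ≤ ‖g b‖ ^ 2 - ‖g a‖ ^ 2 := by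
  rw [norm_sub_sq_real]
  linarith [hg.norm_sq_le_inner hab]

theorem norm_sq_eq_one (hg : IsWeakRankLimit U hφ g) {t : W} (ht : ∀ i x, φ i x < t) :
    ‖g t‖ ^ 2 = 1 := by
  rw [← real_inner_self_eq_norm_sq]
  refine tendsto_nhds_unique (hg t (g t)) (tendsto_const_nhds.congr fun i => ?_)
  rw [real_inner_comm]
  refine tendsto_nhds_unique (tendsto_const_nhds.congr fun j => ?_) (hg t _)
  rw [inner_ltIndicator]
  simp [ht]

/-- Since ‖g‖² is monotone and bounded, `g` is Cauchy from the left at `c`, even if it jumps there.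
-/
theorem exists_norm_sub_le (hg : IsWeakRankLimit U hφ g) {a c : W} (hac : a < c) {ε : ℝ}
    (hε : 0 < ε) : ∃ b, a ≤ b ∧ b < c ∧ ∀ m, b ≤ m → m < c → ‖g m - g b‖ ≤ ε := by
  have hne : ((fun m => ‖g m‖ ^ 2) '' Set.Ico a c).Nonempty := ⟨_, a, ⟨le_rfl, hac⟩, rfl⟩
  have hbdd : BddAbove ((fun m => ‖g m‖ ^ 2) '' Set.Ico a c) := by
    refine ⟨‖g c‖ ^ 2, ?_⟩
    rintro _ ⟨m, hm, rfl⟩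
    linarith [hg.norm_sq_sub_le hm.2.le, sq_nonneg ‖g c - g m‖]
  obtain ⟨_, ⟨b, hb, rfl⟩, hlt⟩ := exists_lt_of_lt_csSup hne (sub_lt_self _ (pow_pos hε 2))
  refine ⟨b, hb.1, hb.2, fun m hbm hmc => le_of_sq_le_sq ?_ hε.le⟩
  have h1 := le_csSup hbdd ⟨m, ⟨hb.1.trans hbm, hmc⟩, rfl⟩
  have h2 := hg.norm_sq_sub_le hbm
  simp only at h1 hlt
  linarith

variable [WellFoundedLT W] [Countable W]

/-- Up to `η`, the mass of `φ i` in [b, c) lies in [b, m]. There φ j < φ i forces φ j < m, whose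
indicator tends weakly to `g m`, within `ε` of `g b`. -/
theorem eventually_measureReal_le (hg : IsWeakRankLimit U hφ g) {b c : W} (hbc : b < c) {ε η : ℝ}
    (hε : ∀ m, b ≤ m → m < c → ‖g m - g b‖ ≤ ε) (hη : 0 < η) (i : ℕ) :
    ∀ᶠ j in U, μ.real {x | φ j x < φ i x ∧ φ i x < c} ≤
      μ.real {x | φ j x < φ i x ∧ φ i x < b} +
        inner ℝ (ltIndicator μ hφ i c - ltIndicator μ hφ i b) (g b) + ε + 2 * η := by
  obtain ⟨m, hbm, hmc, hm⟩ := exists_measureReal_Ioo_le (μ := μ) (hφ i) hbc hη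
  set d := ltIndicator μ hφ i c - ltIndicator μ hφ i b with hd
  have h1 : inner ℝ (g m) d ≤ inner ℝ d (g b) + ε := by
    have h2 : inner ℝ (g m) d = inner ℝ d (g b) + inner ℝ d (g m - g b) := by
      rw [← inner_add_right, add_sub_cancel, real_inner_comm]
    have h3 := real_inner_le_norm d (g m - g b)
    have h4 := mul_le_mul (norm_ltIndicator_sub_le (μ := μ) hφ i hbc.le) (hε m hbm hmc) (norm_nonneg _)
      zero_le_one
    linarith
  filter_upwards [(hg m d).eventually (gt_mem_nhds (lt_add_of_pos_right _ hη))] with j hj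
  have h5 : inner ℝ (ltIndicator μ hφ j m) d = μ.real {x | φ j x < m ∧ b ≤ φ i x ∧ φ i x < c} := by
    rw [hd, inner_sub_right, inner_ltIndicator, inner_ltIndicator, ← measureReal_sdiff]
    · congr 1
      ext x
      simp only [Set.mem_sdiff, Set.mem_ofPred_eq, not_and, not_lt]
      tauto
    · exact fun x hx => ⟨hx.1, hx.2.trans hbc⟩
    · exact (hφ j (MeasurableSet.of_discrete (s := Set.Iio m))).inter
        (hφ i (MeasurableSet.of_discrete (s := Set.Iio b)))
  have h6 : μ.real {x | φ j x < φ i x ∧ φ i x < c} ≤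
      μ.real {x | φ j x < φ i x ∧ φ i x < b} + μ.real {x | m < φ i x ∧ φ i x < c} +
        μ.real {x | φ j x < m ∧ b ≤ φ i x ∧ φ i x < c} := by
    refine (measureReal_mono (fun x hx => ?_)).trans ((measureReal_union_le _ _).trans
      (add_le_add_left (measureReal_union_le _ _) _))
    simp only [Set.mem_ofPred_eq, Set.mem_union] at hx ⊢
    rcases lt_or_ge (φ i x) b with h | h
    · exact Or.inl (Or.inl ⟨hx.1, h⟩)
    rcases lt_or_ge m (φ i x) with h' | h'
    · exact Or.inl (Or.inr ⟨h', hx.2⟩)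
    · exact Or.inr ⟨hx.1.trans_le h', h, hx.2⟩
  linarith

theorem eventually_measureReal_le_norm_sq (hg : IsWeakRankLimit U hφ g) {a : W}
    (ha : ∀ m < a, g m = 0) {c : W} (hac : a ≤ c) {η : ℝ} (hη : 0 < η) :
    ∀ᶠ i in U, ∀ᶠ j in U, μ.real {x | φ j x < φ i x ∧ φ i x < c} ≤
      ‖g c‖ ^ 2 / 2 - ‖g a‖ ^ 2 / 2 + η := by
  induction c using WellFoundedLT.induction generalizing η with
  | ind c ih =>
  rcases hac.eq_or_lt with rfl | hlt
  -- Base case: `g` vanishes below `a`, so the first jump costs nothing.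
  · refine Eventually.of_forall fun i => ?_
    by_cases hmin : ∃ b, b < a
    · obtain ⟨b, hb, hbmin⟩ := WellFounded.has_min (wellFounded_lt (α := W)) (Set.Iio a) hmin
      have hbot : ∀ m, b ≤ m := fun m => by
        by_contra! h
        exact hbmin m (h.trans hb) h
      have := hg.eventually_measureReal_le hb (ε := 0)
        (fun m _ hm => by rw [ha m hm, ha b hb, sub_zero, norm_zero]) (half_pos hη) i
      filter_upwards [this] with j hj
      have h0 : {x | φ j x < φ i x ∧ φ i x < b} = ∅ :=
        Set.eq_empty_iff_forall_notMem.2 fun x hx => (hx.2.trans_le (hbot _)).false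
      rw [h0, measureReal_empty, ha b hb, inner_zero_right] at hj
      linarith
    · refine Eventually.of_forall fun j => ?_
      have h0 : {x | φ j x < φ i x ∧ φ i x < a} = ∅ :=
        Set.eq_empty_iff_forall_notMem.2 fun x hx => hmin ⟨_, hx.2⟩
      rw [h0, measureReal_empty]
      linarith
  · obtain ⟨b, hab, hbc, hb⟩ := hg.exists_norm_sub_le hlt (ε := η / 5) (by positivity)
    have h1 : Tendsto (fun i => inner ℝ (ltIndicator μ hφ i c - ltIndicator μ hφ i b) (g b)) U
        (𝓝 (inner ℝ (g c) (g b) - inner ℝ (g b) (g b))) := by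
      simp only [inner_sub_left]
      exact (hg c _).sub (hg b _)
    filter_upwards [ih b hbc hab (η := η / 5) (by positivity),
      h1.eventually (gt_mem_nhds (lt_add_of_pos_right _ (by positivity : 0 < η / 5)))] with i hi hi'
    filter_upwards [hi, hg.eventually_measureReal_le hbc hb (by positivity : 0 < η / 5) i]
      with j hj hj'
    -- Expanding ‖g c - g b‖² ≥ 0 bounds ⟨g c - g b, g b⟩ by half the increment of ‖g‖².
    have h2 := norm_sub_sq_real (g c) (g b)
    have h3 := sq_nonneg ‖g c - g b‖
    rw [real_inner_self_eq_norm_sq] at hi'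
    linarith

end IsWeakRankLimit

/-- In a sequence of random variables with values in a countable well-order, bounded by an element
of it, some earlier variable exceeds a later one with probability less than `1 / 2`. -/
theorem exists_lt_measureReal_lt_half [WellFoundedLT W] [Countable W] (μ : Measure Ω) [IsProbabilityMeasure μ]
    (hφ : ∀ i, Measurable (φ i)) {t : W} (ht : ∀ i x, φ i x < t) :
    ∃ i j, i < j ∧ μ.real {x | φ j x < φ i x} < 1 / 2 := by
  obtain ⟨g, hg⟩ := exists_isWeakRankLimit (μ := μ) (hyperfilter ℕ) hφ
  have h1 := hg.norm_sq_eq_one ht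
  have hne : g t ≠ 0 := fun h => by simp [h] at h1
  obtain ⟨a, ha, hmin⟩ := WellFounded.has_min (wellFounded_lt (α := W)) {a | g a ≠ 0} ⟨t, hne⟩
  have hat : a ≤ t := not_lt.1 (hmin t hne)
  have hpos : 0 < ‖g a‖ ^ 2 := by
    have : 0 < ‖g a‖ := norm_pos_iff.2 ha
    positivity
  -- The error ‖g a‖² / 4 is less than the gain ‖g a‖² / 2.
  obtain ⟨i, hi⟩ := (hg.eventually_measureReal_le_norm_sq
    (fun m hm => by_contra fun h => hmin m h hm) hat (η := ‖g a‖ ^ 2 / 4) (by positivity)).exists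
  have hgt : ∀ᶠ j in (hyperfilter ℕ : Filter ℕ), i < j :=
    Nat.hyperfilter_le_atTop (eventually_gt_atTop i)
  obtain ⟨j, hj, hij⟩ := (hi.and hgt).exists
  refine ⟨i, j, hij, ?_⟩
  simp only [ht, and_true] at hj
  linarith

end Ranks

/-! ### Infinite paths and measurability -/

section Paths

variable {Ω : Type*}

/-- The event that some `j > i` with `(i, j) ∈ X` lies in the random vertex set `A`. -/
def edgeDerivative (X : Ω → Set NatEdge) (A : ℕ → Set Ω) (i : ℕ) : Set Ω :=
  {x | ∃ j, ∃ h : i < j, (⟨(i, j), h⟩ : NatEdge) ∈ X x ∧ x ∈ A j}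

/-- The event that an infinite path of `X` starts at `i`. -/
def pathFrom (X : Ω → Set NatEdge) (i : ℕ) : Set Ω :=
  {x | ∃ v : ℕ → ℕ, v 0 = i ∧
    ∀ k : ℕ, ∃ h : v k < v (k + 1), (⟨(v k, v (k + 1)), h⟩ : NatEdge) ∈ X x}

theorem infinitePathEvent_eq_iUnion (X : Ω → Set NatEdge) :
    infinitePathEvent X = ⋃ i, pathFrom X i := by
  ext x
  rw [Set.mem_iUnion]
  exact ⟨fun ⟨v, hv⟩ => ⟨v 0, v, rfl, hv⟩, fun ⟨_, v, _, hv⟩ => ⟨v, hv⟩⟩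

theorem edgeDerivative_mono {X : Ω → Set NatEdge} {A B : ℕ → Set Ω} (h : ∀ i, A i ⊆ B i) (i : ℕ) :
    edgeDerivative X A i ⊆ edgeDerivative X B i :=
  fun _ ⟨j, hij, hX, hx⟩ => ⟨j, hij, hX, h j hx⟩

theorem pathFrom_subset_edgeDerivative (X : Ω → Set NatEdge) (i : ℕ) :
    pathFrom X i ⊆ edgeDerivative X (pathFrom X) i := by
  rintro x ⟨v, rfl, hv⟩
  obtain ⟨h, hX⟩ := hv 0
  exact ⟨v 1, h, hX, fun k => v (k + 1), rfl, fun k => hv (k + 1)⟩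

/-- Coinduction: `pathFrom` is the largest family contained in its own derivative. -/
theorem mem_pathFrom_of_forall {X : Ω → Set NatEdge} {A : ℕ → Set Ω} {x : Ω}
    (h : ∀ i, x ∈ A i → x ∈ edgeDerivative X A i) {i : ℕ} (hi : x ∈ A i) : x ∈ pathFrom X i := by
  choose f hf hX hA using h
  let w : ℕ → {i // x ∈ A i} := fun k => Nat.rec ⟨i, hi⟩ (fun _ p => ⟨f p.1 p.2, hA p.1 p.2⟩) k
  exact ⟨fun k => (w k).1, rfl, fun k => ⟨hf _ (w k).2, hX _ (w k).2⟩⟩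

variable [MeasurableSpace Ω] {μ : Measure Ω} {X : Ω → Set NatEdge}

theorem IsRandomSubgraph.measurableSet_edgeEvent (hX : IsRandomSubgraph X) (e : NatEdge) :
    MeasurableSet (edgeEvent X e) :=
  measurable_set_iff.1 hX e |>.setOf

theorem IsRandomSubgraph.measurableSet_edgeDerivative (hX : IsRandomSubgraph X) {A : ℕ → Set Ω}
    (hA : ∀ i, MeasurableSet (A i)) (i : ℕ) : MeasurableSet (edgeDerivative X A i) := by
  have : edgeDerivative X A i = ⋃ j, ⋃ h : i < j, edgeEvent X ⟨(i, j), h⟩ ∩ A j := by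
    ext x
    simp [edgeDerivative, edgeEvent]
  rw [this]
  exact .iUnion fun j => .iUnion fun h => (hX.measurableSet_edgeEvent _).inter (hA j)

theorem ae_mem_pathFrom {A : ℕ → Set Ω} (h : ∀ i, μ (A i \ edgeDerivative X A i) = 0) (i : ℕ) :
    A i ≤ᵐ[μ] pathFrom X i := by
  have h' : ∀ᵐ x ∂μ, ∀ i, x ∈ A i → x ∈ edgeDerivative X A i :=
    ae_all_iff.2 fun i => ae_le_set.2 (h i)
  filter_upwards [h'] with x hx hi
  exact mem_pathFrom_of_forall hx hi

theorem IsRandomSubgraph.nullMeasurableSet_pathFrom [IsFiniteMeasure μ] (hX : IsRandomSubgraph X)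
    (i : ℕ) : NullMeasurableSet (pathFrom X i) μ := by
  let A : ℕ → Set Ω := fun i => toMeasurable μ (pathFrom X i)
  have hA : ∀ i, MeasurableSet (A i) := fun i => measurableSet_toMeasurable _ _
  have hsub : ∀ i, pathFrom X i ⊆ A i := fun i => subset_toMeasurable _ _
  have hD := hX.measurableSet_edgeDerivative hA
  -- The derivative of the hulls still covers `pathFrom`, so by minimality it contains each hull up
  -- to a null set.
  have h : ∀ i, μ (A i \ edgeDerivative X A i) = 0 := fun i => by
    have h1 : μ (A i) ≤ μ (A i ∩ edgeDerivative X A i) :=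
      (measure_toMeasurable (pathFrom X i)).trans_le (measure_mono (Set.subset_inter (hsub i)
        ((pathFrom_subset_edgeDerivative X i).trans (edgeDerivative_mono hsub i))))
    rw [← Set.sdiff_self_inter, measure_sdiff Set.inter_subset_left
      ((hA i).inter (hD i)).nullMeasurableSet (measure_ne_top _ _), tsub_eq_zero_of_le h1]
  exact (hA i).nullMeasurableSet.congr ((ae_mem_pathFrom h i).antisymm (hsub i).eventuallyLE)

theorem IsRandomSubgraph.nullMeasurableSet_infinitePathEvent [IsFiniteMeasure μ]
    (hX : IsRandomSubgraph X) : NullMeasurableSet (infinitePathEvent X) μ := by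
  rw [infinitePathEvent_eq_iUnion]
  exact .iUnion hX.nullMeasurableSet_pathFrom

end Paths

/-! ### Stationarity below ω₁ -/

section Ordinals

open Ordinal

theorem Ordinal.countable_Iio_of_lt_omega_one {a : Ordinal} (ha : a < ω₁) :
    Countable (Set.Iio a) := by
  rw [← Cardinal.mk_le_aleph0_iff, Cardinal.mk_Iio_ordinal, Cardinal.lift_le_aleph0]
  rw [← Order.lt_succ_iff, Cardinal.succ_aleph0, ← Cardinal.lt_ord, Cardinal.ord_aleph]
  exact ha

theorem Ordinal.add_one_lt_omega_one {a : Ordinal} (ha : a < ω₁) : a + 1 < ω₁ :=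
  (Cardinal.isSuccLimit_omega 1).add_one_lt ha

/-- Countably many antitone functions on the countable ordinals are simultaneously stationary at
some point. -/
theorem Ordinal.exists_lt_omega_one_forall_eq {ι : Type*} [Countable ι]
    {f : ι → Ordinal → ENNReal} (hf : ∀ i, Antitone (f i)) :
    ∃ a < ω₁, ∀ i, f i (a + 1) = f i a := by
  have h : ∀ i, ∃ a < ω₁, ∀ b < ω₁, f i a ≤ f i b := fun i => by
    have hne : (f i '' Set.Iio ω₁).Nonempty := ⟨_, 0, omega_pos 1, rfl⟩
    obtain ⟨u, -, hu, hmem⟩ := exists_seq_tendsto_sInf hne (OrderBot.bddBelow _)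
    choose a ha hau using hmem
    -- A countable supremum of countable ordinals is countable, so the infimum is attained.
    refine ⟨⨆ n, a n, iSup_lt_omega_one ha, fun b hb => ?_⟩
    refine le_trans (ge_of_tendsto' hu fun n => ?_) (csInf_le (OrderBot.bddBelow _) ⟨b, hb, rfl⟩)
    rw [← hau n]
    exact hf i (Ordinal.le_iSup a n)
  choose a ha hmin using h
  have hlt : ⨆ i, a i < ω₁ := iSup_lt_omega_one ha
  refine ⟨⨆ i, a i, hlt, fun i => (hf i le_self_add).antisymm ?_⟩
  exact (hf i (Ordinal.le_iSup a i)).trans (hmin i _ (add_one_lt_omega_one hlt))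

end Ordinals

/-! ### Ordinal ranks of vertices -/

section RankEvent

open Ordinal

variable {Ω : Type*} {X : Ω → Set NatEdge}

/-- The event that the vertex `i` has rank at least `a` for the relation `j ≻ i ↔ (i, j) ∈ X`. -/
def rankEvent (X : Ω → Set NatEdge) (a : Ordinal.{0}) (i : ℕ) : Set Ω :=
  ⋂ b : Set.Iio a, edgeDerivative X (rankEvent X b.1) i
termination_by a
decreasing_by exact b.2

theorem mem_rankEvent {a : Ordinal.{0}} {i : ℕ} {x : Ω} :
    x ∈ rankEvent X a i ↔ ∀ b < a, x ∈ edgeDerivative X (rankEvent X b) i := by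
  rw [rankEvent]
  simp

theorem antitone_rankEvent (X : Ω → Set NatEdge) (i : ℕ) : Antitone fun a => rankEvent X a i :=
  fun _ _ hab _ hx => mem_rankEvent.2 fun c hc => mem_rankEvent.1 hx c (hc.trans_le hab)

theorem rankEvent_add_one (a : Ordinal.{0}) (i : ℕ) :
    rankEvent X (a + 1) i = edgeDerivative X (rankEvent X a) i := by
  ext x
  refine ⟨fun hx => mem_rankEvent.1 hx a (lt_add_one a), fun hx => mem_rankEvent.2 fun b hb => ?_⟩
  exact edgeDerivative_mono (fun j => antitone_rankEvent X j (Order.lt_add_one_iff.1 hb)) i hx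

theorem mem_rankEvent_iff_add_one {a : Ordinal.{0}} {i : ℕ} {x : Ω} :
    x ∈ rankEvent X a i ↔ ∀ b < a, x ∈ rankEvent X (b + 1) i := by
  simp only [rankEvent_add_one, mem_rankEvent]

theorem IsRandomSubgraph.measurableSet_rankEvent [MeasurableSpace Ω] (hX : IsRandomSubgraph X)
    {a : Ordinal.{0}} (ha : a < ω₁) (i : ℕ) : MeasurableSet (rankEvent X a i) := by
  induction a using WellFoundedLT.induction generalizing i with
  | ind a ih =>
  rw [rankEvent]
  have := countable_Iio_of_lt_omega_one ha
  exact .iInter fun b => hX.measurableSet_edgeDerivative (ih b b.2 (b.2.trans ha)) i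

/-- The rank of the vertex `i`, cut off at `a`. -/
noncomputable def cutRank (X : Ω → Set NatEdge) (a : Ordinal.{0}) (i : ℕ) (x : Ω) : Ordinal.{0} :=
  sInf {b | b = a ∨ x ∉ rankEvent X (b + 1) i}

theorem cutRank_le (X : Ω → Set NatEdge) (a : Ordinal.{0}) (i : ℕ) (x : Ω) :
    cutRank X a i x ≤ a :=
  csInf_le' (Or.inl rfl)

theorem le_cutRank_iff {a b : Ordinal.{0}} (hb : b ≤ a) {i : ℕ} {x : Ω} :
    b ≤ cutRank X a i x ↔ x ∈ rankEvent X b i := by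
  rw [cutRank, le_csInf_iff'' ⟨a, Or.inl rfl⟩, mem_rankEvent_iff_add_one]
  refine ⟨fun h c hc => by_contra fun hx => hc.not_ge (h c (Or.inr hx)), ?_⟩
  rintro h c (rfl | hc)
  · exact hb
  · exact not_lt.1 fun hcb => hc (h c hcb)

/-- The hypothesis on `j` excludes that both ranks are cut off at `a`. -/
theorem cutRank_lt_cutRank {a : Ordinal.{0}} {i j : ℕ} {x : Ω} (hij : i < j)
    (hX : (⟨(i, j), hij⟩ : NatEdge) ∈ X x) (hj : x ∉ rankEvent X a j) :
    cutRank X a j x < cutRank X a i x := by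
  have hlt : cutRank X a j x < a := not_le.1 fun h => hj ((le_cutRank_iff le_rfl).1 h)
  rw [← Order.add_one_le_iff, le_cutRank_iff (Order.add_one_le_iff.2 hlt), rankEvent_add_one]
  exact ⟨j, hij, hX, (le_cutRank_iff hlt.le).1 le_rfl⟩

variable [MeasurableSpace Ω]

theorem IsRandomSubgraph.measure_infinitePathEvent_pos {μ : Measure Ω} [IsProbabilityMeasure μ]
    (hX : IsRandomSubgraph X) (h : ∀ e, 1 / 2 ≤ μ (edgeEvent X e)) :
    0 < μ (infinitePathEvent X) := by
  by_contra! hP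
  rw [nonpos_iff_eq_zero] at hP
  obtain ⟨a, ha, hstat⟩ := exists_lt_omega_one_forall_eq (f := fun i a => μ (rankEvent X a i))
    fun i _ _ hab => measure_mono (antitone_rankEvent X i hab)
  have ha1 := add_one_lt_omega_one ha
  have hnull : ∀ i, μ (rankEvent X a i) = 0 := fun i => by
    have h1 := ae_mem_pathFrom (μ := μ) (X := X) (A := rankEvent X a) (fun i => by
      rw [← rankEvent_add_one, measure_sdiff (antitone_rankEvent X i le_self_add)
        (hX.measurableSet_rankEvent ha1 i).nullMeasurableSet (measure_ne_top _ _), hstat,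
        tsub_self]) i
    refine le_antisymm ((measure_mono_ae h1).trans ?_) zero_le
    rw [← hP, infinitePathEvent_eq_iUnion]
    exact measure_mono (Set.subset_iUnion _ i)
  -- Cut ranks are at most `a`; `W` also contains the strict bound `a + 1`.
  let W := Set.Iio (a + 1 + 1)
  have : Countable W := countable_Iio_of_lt_omega_one (add_one_lt_omega_one ha1)
  let _ : MeasurableSpace W := ⊤
  let φ : ℕ → Ω → W := fun i x =>
    ⟨cutRank X a i x, (cutRank_le X a i x).trans_lt ((lt_add_one a).trans (lt_add_one _))⟩
  have hle : ∀ i (w : W), MeasurableSet {x | w ≤ φ i x} := fun i w => by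
    change MeasurableSet {x | w.1 ≤ cutRank X a i x}
    rcases le_or_gt w.1 a with hw | hw
    · simp only [le_cutRank_iff hw]
      exact hX.measurableSet_rankEvent (hw.trans_lt ha) i
    · simp only [fun x => ((cutRank_le X a i x).trans_lt hw).not_ge]
      exact .const False
  have hφ : ∀ i, Measurable (φ i) := fun i => measurable_to_countable' fun w => by
    have : φ i ⁻¹' {w} = {x | w ≤ φ i x} \ ⋃ v : Set.Ioi w, {x | v.1 ≤ φ i x} := by
      ext x
      simp only [Set.mem_preimage, Set.mem_singleton_iff, Set.mem_sdiff, Set.mem_iUnion,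
        Set.mem_ofPred_eq, not_exists, not_le]
      exact ⟨fun h => ⟨h.ge, fun v => h.trans_lt v.2⟩, fun h => h.1.antisymm'
        (not_lt.1 fun hlt => (h.2 ⟨_, hlt⟩).false)⟩
    rw [this]
    exact (hle i w).diff (.iUnion fun v => hle i v.1)
  obtain ⟨i, j, hij, hlt⟩ := exists_lt_measureReal_lt_half μ hφ (t := ⟨a + 1, lt_add_one (a + 1)⟩)
    fun i x => Order.lt_add_one_iff.2 (cutRank_le X a i x)
  have hsub : edgeEvent X ⟨(i, j), hij⟩ ≤ᵐ[μ] {x | φ j x < φ i x} := by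
    filter_upwards [measure_eq_zero_iff_ae_notMem.1 (hnull j)] with x hx hxX
    exact cutRank_lt_cutRank hij hxX hx
  refine hlt.not_ge ?_
  have := ENNReal.toReal_mono (measure_ne_top _ _) ((h _).trans (measure_mono_ae hsub))
  simpa [Measure.real] using this

end RankEvent

/-! ### Sharpness of the bound -/

section Uniform

open ProbabilityTheory

theorem uniformOn_univ_prod_diagonal (n : ℕ) [NeZero n] :
    ((uniformOn (Set.univ : Set (Fin n))).prod (uniformOn Set.univ)).real
      {p : Fin n × Fin n | p.1 = p.2} = 1 / n := by
  rw [Measure.real, Measure.prod_apply .of_discrete]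
  have : ∀ x : Fin n, uniformOn (Set.univ : Set (Fin n)) (Prod.mk x ⁻¹' {p | p.1 = p.2}) =
      (n : ENNReal)⁻¹ := fun x => by
    have h : Prod.mk x ⁻¹' {p : Fin n × Fin n | p.1 = p.2} = {x} := by
      ext y; simp [eq_comm]
    rw [h, uniformOn_univ]
    simp
  rw [lintegral_congr this]
  simp

theorem uniformOn_univ_prod_lt (n : ℕ) [NeZero n] :
    ((uniformOn (Set.univ : Set (Fin n))).prod (uniformOn Set.univ)).real
      {p : Fin n × Fin n | p.2 < p.1} = (1 - 1 / n) / 2 := by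
  set P := (uniformOn (Set.univ : Set (Fin n))).prod (uniformOn (Set.univ : Set (Fin n))) with hP
  have hswap : P.real {p | p.1 < p.2} = P.real {p | p.2 < p.1} := by
    have h := map_measureReal_apply (μ := P) (f := Prod.swap) measurable_swap
      (MeasurableSet.of_discrete (s := {p : Fin n × Fin n | p.1 < p.2}))
    rw [hP, Measure.prod_swap] at h
    exact h
  have hcompl := measureReal_add_measureReal_compl (μ := P)
    (s := {p | p.1 = p.2}) .of_discrete
  have hunion : {p : Fin n × Fin n | p.1 = p.2}ᶜ = {p | p.1 < p.2} ∪ {p | p.2 < p.1} := by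
    ext p
    simp
  have hdisj : Disjoint {p : Fin n × Fin n | p.1 < p.2} {p | p.2 < p.1} :=
    Set.disjoint_left.2 fun p h1 h2 => lt_asymm (α := Fin n) h1 h2
  rw [hunion, measureReal_union hdisj .of_discrete, hswap, uniformOn_univ_prod_diagonal] at hcompl
  simp only [probReal_univ] at hcompl
  linarith

/-- Independent uniform vertex labels in `Fin n`, with `(i, j)` an edge if the label of `j` is
smaller than that of `i`: the edge probabilities tend to `1 / 2`, but there is no infinite path. -/
theorem exists_isRandomSubgraph_forall_not_hasInfinitePath {r : ℝ} (hr : r < 1 / 2) :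
    ∃ (Ω : Type) (_ : MeasurableSpace Ω) (μ : Measure Ω) (_ : IsProbabilityMeasure μ)
      (X : Ω → Set NatEdge), IsRandomSubgraph X ∧
      (∀ e : NatEdge, r ≤ μ.real (edgeEvent X e)) ∧ ∀ x : Ω, ¬ HasInfinitePath (X x) := by
  obtain ⟨n, hn⟩ := exists_nat_one_div_lt (show (0 : ℝ) < 1 - 2 * r by linarith)
  have hlt : MeasurableSet {p : Fin (n + 1) × Fin (n + 1) | p.2 < p.1} := .of_discrete
  have hmeas : ∀ i j : ℕ, Measurable fun ω : ℕ → Fin (n + 1) => (ω i, ω j) := fun i j => by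
    fun_prop
  refine ⟨ℕ → Fin (n + 1), inferInstance, Measure.infinitePi fun _ => uniformOn Set.univ,
    inferInstance, fun ω => {e | ω e.1.2 < ω e.1.1}, ?_, fun e => ?_, ?_⟩
  · exact measurable_set_iff.2 fun e => measurableSet_setOfPred.1 (hmeas e.1.1 e.1.2 hlt)
  · have h := map_measureReal_apply
      (μ := Measure.infinitePi fun _ : ℕ => uniformOn (Set.univ : Set (Fin (n + 1))))
      (hmeas e.1.1 e.1.2) hlt
    rw [Measure.infinitePi_map_eval_prod e.2.ne, uniformOn_univ_prod_lt] at h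
    refine le_trans ?_ h.le
    push_cast
    linarith
  · rintro ω ⟨v, hv⟩
    exact not_strictAnti_of_wellFoundedLT (fun k => ω (v k))
      (strictAnti_nat_of_succ_lt fun k => (hv k).2)

end Uniform

theorem theorem4p5 :
    -- edge probabilities at least `1 / 2` force an infinite path with positive probability;
    -- in particular some increasing sequence has consecutive edge events with a common point
    (∀ (Ω : Type*) [MeasurableSpace Ω] (μ : Measure Ω) [IsProbabilityMeasure μ]
        (X : Ω → Set NatEdge), IsRandomSubgraph X →
        (∀ e : NatEdge, 1 / 2 ≤ μ (edgeEvent X e)) →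
        NullMeasurableSet (infinitePathEvent X) μ ∧ 0 < μ (infinitePathEvent X) ∧
        ∃ (n : ℕ → ℕ) (hn : StrictMono n),
          (⋂ k : ℕ, edgeEvent X ⟨(n k, n (k + 1)), hn k.lt_succ_self⟩).Nonempty) ∧
    -- the bound `1 / 2` is sharp
    (∀ r : ℝ, r < 1 / 2 →
      ∃ (Ω : Type) (_ : MeasurableSpace Ω) (μ : Measure Ω) (_ : IsProbabilityMeasure μ)
        (X : Ω → Set NatEdge), IsRandomSubgraph X ∧
        (∀ e : NatEdge, r ≤ μ.real (edgeEvent X e)) ∧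
        ∀ x : Ω, ¬ HasInfinitePath (X x)) := by
  refine ⟨fun Ω _ μ _ X hX h => ?_, fun r hr =>
    exists_isRandomSubgraph_forall_not_hasInfinitePath hr⟩
  have hpos := hX.measure_infinitePathEvent_pos h
  refine ⟨hX.nullMeasurableSet_infinitePathEvent, hpos, ?_⟩
  obtain ⟨x, v, hv⟩ := nonempty_of_measure_ne_zero hpos.ne'
  exact ⟨v, strictMono_nat_of_lt_succ fun k => (hv k).1, x, Set.mem_iInter.2 fun k => (hv k).2⟩
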